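/- Let $n\ge 1$ and let $\Omega\subset\mathbb{R}^n$ be a convex polytope, i.e. the convex hull of finitely many points, with non-empty interior. Write $\mathrm{vol}$ for $n$-dimensional Lebesgue measure, $\mathrm{In}(\Omega)$ for the inradius of $\Omega$ (the radius of the largest ball contained in $\Omega$), and for $\varepsilon\ge 0$ let $$L_\varepsilon(\Omega)=\{x\in\Omega : \|x-y\|\le\varepsilon \text{ for some } y\in\partial\Omega\},\qquad g(\varepsilon)=\mathrm{vol}(\Omega)\left(1-\max\left(0,\,1-\frac{\varepsilon}{\mathrm{In}(\Omega)}\right)^{n}\right).$$ Then the function $\varepsilon\mapsto \mathrm{vol}(L_\varepsilon(\Omega))$ is continuously differentiable on $[0,\mathrm{In}(\Omega)]$ (one-sided derivatives at the endpoints) with a (weakly) decreasing derivative there. It is concave on $[0,\infty)$, and $$\mathrm{vol}(L_\varepsilon(\Omega))\;\ge\;\varepsilon\,\frac{\mathrm{vol}(\Omega)}{\mathrm{In}(\Omega)}\;\ge\;\frac{g(\varepsilon)}{n}\qquad\text{for all }\varepsilon\in[0,\mathrm{In}(\Omega)].$$ -/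

import Mathlib

open MeasureTheory Set

noncomputable section

namespace InnerNeighbourhood

/-- A (full-dimensional, convex) polytope in `ℝⁿ`: the convex hull of finitely many points,
with non-empty interior. -/
structure IsPolytope {n : ℕ} (Ω : Set (EuclideanSpace ℝ (Fin n))) : Prop where
  exists_finite : ∃ s : Set (EuclideanSpace ℝ (Fin n)), s.Finite ∧ Ω = convexHull ℝ s
  interior_nonempty : (interior Ω).Nonempty

/-- `vol(Ω)`: the `n`-dimensional Lebesgue measure, as a real number. -/
def vol {n : ℕ} (Ω : Set (EuclideanSpace ℝ (Fin n))) : ℝ :=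
  (volume Ω).toReal

/-- The inradius `In(Ω)`: the radius of the largest ball contained in `Ω`. -/
def inradius {n : ℕ} (Ω : Set (EuclideanSpace ℝ (Fin n))) : ℝ :=
  sSup {r : ℝ | 0 ≤ r ∧ ∃ x, Metric.closedBall x r ⊆ Ω}

/-- The `ε`-inner neighbourhood `L_ε(Ω)`: the points of `Ω` at most `ε` away from `∂Ω`. -/
def innerNhd {n : ℕ} (Ω : Set (EuclideanSpace ℝ (Fin n))) (ε : ℝ) :
    Set (EuclideanSpace ℝ (Fin n)) :=
  {x | x ∈ Ω ∧ ∃ y ∈ frontier Ω, ‖x - y‖ ≤ ε}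

/-- `g(ε) = vol(Ω) (1 - max(0, 1 - ε / In(Ω))ⁿ)`. -/
def g {n : ℕ} (Ω : Set (EuclideanSpace ℝ (Fin n))) (ε : ℝ) : ℝ :=
  vol Ω * (1 - max 0 (1 - ε / inradius Ω) ^ n)

end InnerNeighbourhood

end

/-! ### Real analysis: continuity of monotone derivatives, differentiability of concave functions.
-/

noncomputable section

namespace InnerNeighbourhood

open Filter Topology

section RealAnalysis

/-! Write Ω as finitely many inequalities `gap b a ≥ 0` with unit normals `a`. Up to null sets, L_ε
is the disjoint union over the facets of the cells of points nearest to that facet at distance in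
(0, ε].

Concavity: stretching along `a` maps the layer (y, z] of a cell into the layer (x, y] and multiplies
volume by (y - x)/(z - y), so layers only get thinner going inwards (`mul_measure_cell_le`).

Differentiability: pushing an outer layer of width h inwards by h lands in the next layer, except
for points almost equidistant from a second facet. Those lie in two crossing slabs of width O(h) and
have volume O(h²) (`exists_measureReal_cell_le`). Hence second differences are at least -Ch², which
excludes a corner of a concave function. Parallel facets do no harm below the inradius, and at the
inradius only a left derivative is needed. Volumes are counted from signed distance -1, so that 0
becomes an interior point.

A monotone derivative is continuous by Darboux. The lower bound is the chord of the concave function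
over [0, In(Ω)]; the comparison with g is Bernoulli's inequality. -/

theorem continuousOn_of_monotoneOn_of_ordConnected_image {g : ℝ → ℝ} {a b : ℝ} (hab : a ≤ b)
    (hg : MonotoneOn g (Icc a b)) (hc : OrdConnected (g '' Icc a b)) :
    ContinuousOn g (Icc a b) := by
  have ha : a ∈ Icc a b := left_mem_Icc.2 hab
  have hb : b ∈ Icc a b := right_mem_Icc.2 hab
  let φ : Icc a b → Icc (g a) (g b) := fun x =>
    ⟨g x, hg ha x.2 x.2.1, hg x.2 hb x.2.2⟩
  have hm : Monotone φ := fun x y hxy => hg x.2 y.2 hxy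
  have hs : Function.Surjective φ := by
    rintro ⟨y, hy⟩
    obtain ⟨x, hx, hxy⟩ := hc.out (mem_image_of_mem g ha) (mem_image_of_mem g hb) hy
    exact ⟨⟨x, hx⟩, Subtype.ext hxy⟩
  have h := continuous_subtype_val.comp (hm.continuous_of_surjective hs)
  exact continuousOn_iff_continuous_domRestrict.2 h

/-- By Darboux the derivative maps the interval onto an order-connected set, and a monotone function
with such an image cannot jump. -/
theorem contDiffOn_one_of_antitoneOn_derivWithin {f : ℝ → ℝ} {a b : ℝ} (hab : a < b)
    (hf : DifferentiableOn ℝ f (Icc a b))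
    (hanti : AntitoneOn (derivWithin f (Icc a b)) (Icc a b)) :
    ContDiffOn ℝ 1 f (Icc a b) := by
  refine (contDiffOn_one_iff_derivWithin (uniqueDiffOn_Icc hab)).2 ⟨hf, ?_⟩
  have h : ContinuousOn (fun x => - derivWithin f (Icc a b) x) (Icc a b) := by
    refine continuousOn_of_monotoneOn_of_ordConnected_image hab.le hanti.neg ?_
    exact ordConnected_Icc.image_hasDerivWithinAt fun x hx => ((hf x hx).hasDerivWithinAt).neg
  exact h.neg.congr fun x _ => (neg_neg _).symm

/-- A concave function whose symmetric second differences are eventually bounded below by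
`-C h²` is differentiable at the given interior point. -/
theorem differentiableAt_of_concaveOn_of_second_difference {F : ℝ → ℝ} {S : Set ℝ} {t C : ℝ}
    (hF : ConcaveOn ℝ S F) (ht : t ∈ interior S)
    (h2 : ∀ᶠ h in 𝓝[>] (0 : ℝ), F t - F (t - h) ≤ F (t + h) - F t + C * h ^ 2) :
    DifferentiableAt ℝ F t := by
  have hc : ConvexOn ℝ S (-F) := hF.neg
  have hr := hc.hasDerivWithinAt_rightDeriv_of_mem_interior ht
  have hl := hc.hasDerivWithinAt_leftDeriv_of_mem_interior ht
  have hle := hc.leftDeriv_le_rightDeriv_of_mem_interior ht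
  set r := derivWithin (-F) (Ioi t) t
  set l := derivWithin (-F) (Iio t) t
  have hr' := (hasDerivWithinAt_iff_tendsto_slope' self_notMem_Ioi).1 hr
  have hl' := (hasDerivWithinAt_iff_tendsto_slope' self_notMem_Iio).1 hl
  have mr : Tendsto (fun h : ℝ => t + h) (𝓝[>] 0) (𝓝[>] t) := by
    refine tendsto_nhdsWithin_iff.2 ⟨?_, ?_⟩
    · have : Tendsto (fun h : ℝ => t + h) (𝓝 0) (𝓝 (t + 0)) :=
        Continuous.tendsto (by fun_prop) 0
      simpa using this.mono_left nhdsWithin_le_nhds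
    · filter_upwards [self_mem_nhdsWithin] with h hh
      simpa using hh
  have ml : Tendsto (fun h : ℝ => t - h) (𝓝[>] 0) (𝓝[<] t) := by
    refine tendsto_nhdsWithin_iff.2 ⟨?_, ?_⟩
    · have : Tendsto (fun h : ℝ => t - h) (𝓝 0) (𝓝 (t - 0)) :=
        Continuous.tendsto (by fun_prop) 0
      simpa using this.mono_left nhdsWithin_le_nhds
    · filter_upwards [self_mem_nhdsWithin] with h hh
      simpa using hh
  have h0 : Tendsto (fun h : ℝ => C * h) (𝓝[>] 0) (𝓝 0) := by
    have : Tendsto (fun h : ℝ => C * h) (𝓝 0) (𝓝 (C * 0)) :=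
        Continuous.tendsto (by fun_prop) 0
    simpa using this.mono_left nhdsWithin_le_nhds
  -- Convexity of `-F` gives `l ≤ r`; dividing the second-difference bound by `h` and letting `h →
  -- 0` gives the converse.
  have hrl : r ≤ l := by
    have := le_of_tendsto_of_tendsto (hr'.comp mr) ((hl'.comp ml).add h0) ?_
    · simpa using this
    filter_upwards [h2, self_mem_nhdsWithin] with h hh hpos
    have hpos : 0 < h := hpos
    simp only [Function.comp, slope_def_field, Pi.neg_apply]
    rw [show t + h - t = h by ring, show t - h - t = -h by ring, div_neg, ← sub_nonneg]
    have : -((-F (t - h) - -F t) / h) + C * h - (-F (t + h) - -F t) / h =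
        (F (t + h) - F t + C * h ^ 2 - (F t - F (t - h))) / h := by
      field_simp; ring
    rw [this]
    exact div_nonneg (by linarith) hpos.le
  have hrl : l = r := le_antisymm hle hrl
  rw [hrl] at hl'
  have h : HasDerivAt (-F) r t := hasDerivAt_iff_tendsto_slope_left_right.2 ⟨hl', hr'⟩
  simpa using h.neg.differentiableAt

end RealAnalysis

end InnerNeighbourhood

end

/-! ### Minkowski–Weyl: polytopes as finite intersections of half-spaces. -/

noncomputable section

namespace InnerNeighbourhood

open scoped NNReal RealInnerProductSpace

section MinkowskiWeyl

variable {V : Type*} [AddCommGroup V] [Module ℝ V]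

/-- One step of Fourier–Motzkin elimination: adding a ray to a polyhedral cone. -/
theorem exists_forall_nonneg_iff_add_ray (T : Finset (Module.Dual ℝ V)) (v : V) :
    ∃ T' : Finset (Module.Dual ℝ V), ∀ x,
      (∃ t : ℝ, 0 ≤ t ∧ ∀ f ∈ T, 0 ≤ f (x - t • v)) ↔ ∀ f ∈ T', 0 ≤ f x := by
  classical
  refine ⟨T.filter (fun f => 0 ≤ f v) ∪
    -- Each pair of opposite signs at `v` is combined so that `v` is annihilated; the default `0`
    -- imposes no condition.
    (T ×ˢ T).image (fun p => if 0 < p.1 v ∧ p.2 v < 0 then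
      (-(p.2 v)) • p.1 + (p.1 v) • p.2 else 0), fun x => ?_⟩
  simp only [Finset.mem_union, Finset.mem_filter, Finset.mem_image, Finset.mem_product,
    map_sub, map_smul, smul_eq_mul]
  constructor
  · rintro ⟨t, ht, h⟩ f (⟨hf, hfv⟩ | ⟨⟨p, q⟩, ⟨hp, hq⟩, rfl⟩)
    · nlinarith [h f hf, mul_nonneg ht hfv]
    · dsimp only
      split_ifs with hs
      · have h1 := h p hp
        have h2 := h q hq
        simp only [LinearMap.add_apply, LinearMap.smul_apply, smul_eq_mul]
        nlinarith [mul_nonneg (neg_nonneg.2 hs.2.le) h1, mul_nonneg hs.1.le h2]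
      · simp
  · intro h
    -- Functionals negative at `v` bound `t` from below by `f x / f v`. The greatest lower bound on
    -- `t`, with `0` included, is the witness; the paired functionals keep it under the upper
    -- bounds.
    let U : Finset ℝ := insert 0 ((T.filter (fun f => f v < 0)).image (fun f => f x / f v))
    have hU : U.Nonempty := Finset.insert_nonempty _ _
    refine ⟨U.max' hU, U.le_max' 0 (Finset.mem_insert_self _ _), fun f hf => ?_⟩
    rcases lt_or_ge (f v) 0 with hfv | hfv
    · have h1 : f x / f v ≤ U.max' hU := U.le_max' _ <| Finset.mem_insert_of_mem <|
        Finset.mem_image.2 ⟨f, Finset.mem_filter.2 ⟨hf, hfv⟩, rfl⟩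
      rw [div_le_iff_of_neg hfv] at h1
      linarith
    · have hfx : 0 ≤ f x := h f (Or.inl ⟨hf, hfv⟩)
      rcases hfv.eq_or_lt with h0 | hfv
      · simpa [← h0] using hfx
      rcases Finset.mem_insert.1 (U.max'_mem hU) with h1 | h1
      · simpa [h1] using hfx
      · obtain ⟨q, hq, hqx⟩ := Finset.mem_image.1 h1
        obtain ⟨hq, hqv⟩ := Finset.mem_filter.1 hq
        have := h _ (Or.inr ⟨(f, q), ⟨hf, hq⟩, rfl⟩)
        rw [if_pos ⟨hfv, hqv⟩] at this
        simp only [LinearMap.add_apply, LinearMap.smul_apply, smul_eq_mul] at this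
        rw [← hqx, sub_nonneg, div_mul_eq_mul_div, div_le_iff_of_neg hqv]
        nlinarith

theorem smul_mem_span_nnreal {s : Set V} {c : ℝ} (hc : 0 ≤ c) {x : V}
    (hx : x ∈ Submodule.span ℝ≥0 s) : c • x ∈ Submodule.span ℝ≥0 s :=
  Submodule.smul_mem _ (NNReal.mk c hc) hx

/-- Finitely generated cones are finite intersections of half-spaces. -/
theorem exists_mem_span_nnreal_iff [FiniteDimensional ℝ V] (s : Finset V) :
    ∃ T : Finset (Module.Dual ℝ V), ∀ x,
      x ∈ Submodule.span ℝ≥0 (s : Set V) ↔ ∀ f ∈ T, 0 ≤ f x := by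
  classical
  induction s using Finset.induction_on with
  | empty =>
    let B := Module.finBasis ℝ V
    refine ⟨Finset.univ.image B.coord ∪ Finset.univ.image (fun i => -B.coord i), fun x => ?_⟩
    simp only [Finset.coe_empty, Submodule.span_empty, Submodule.mem_bot, Finset.mem_union,
      Finset.mem_image, Finset.mem_univ, true_and]
    constructor
    · rintro rfl f -
      simp
    · intro h
      refine B.forall_coord_eq_zero_iff.1 fun i => le_antisymm ?_ ?_
      · simpa using h _ (Or.inr ⟨i, rfl⟩)
      · exact h _ (Or.inl ⟨i, rfl⟩)
  | insert v s _ ih =>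
    obtain ⟨T, hT⟩ := ih
    obtain ⟨T', hT'⟩ := exists_forall_nonneg_iff_add_ray T v
    refine ⟨T', fun x => ?_⟩
    rw [← hT', Finset.coe_insert, Submodule.mem_span_insert]
    constructor
    · rintro ⟨t, z, hz, rfl⟩
      refine ⟨t, t.2, (hT _).1 ?_⟩
      rwa [NNReal.smul_def, add_sub_cancel_left]
    · rintro ⟨t, ht, h⟩
      exact ⟨NNReal.mk t ht, _, (hT _).2 h, by rw [NNReal.smul_def, NNReal.coe_mk]; simp⟩

/-- Homogenization: the hull is the slice at height one of the cone over `s`, so the result for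
cones applies. -/
theorem mem_convexHull_iff_mem_span {s : Set V} (hs : s.Nonempty) (x : V) :
    x ∈ convexHull ℝ s ↔ (x, (1 : ℝ)) ∈ Submodule.span ℝ≥0 ((fun y => (y, (1 : ℝ))) '' s) := by
  constructor
  · intro hx
    have hconv : Convex ℝ
        {y : V | (y, (1 : ℝ)) ∈ Submodule.span ℝ≥0 ((fun y => (y, (1 : ℝ))) '' s)} := by
      intro y hy z hz p q hp hq hpq
      rw [mem_ofPred_eq] at hy hz ⊢
      have h := add_mem (smul_mem_span_nnreal hp hy) (smul_mem_span_nnreal hq hz)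
      have e : p • (y, (1 : ℝ)) + q • (z, (1 : ℝ)) = (p • y + q • z, (1 : ℝ)) := by
        simp [hpq]
      rwa [e] at h
    have hsub : s ⊆ {y : V | (y, (1 : ℝ)) ∈
        Submodule.span ℝ≥0 ((fun y => (y, (1 : ℝ))) '' s)} := fun y hy => by
      rw [mem_ofPred_eq]
      exact Submodule.subset_span ⟨y, hy, rfl⟩
    have h := convexHull_min hsub hconv hx
    rwa [mem_ofPred_eq] at h
  · intro hx
    have key : ∀ z : V × ℝ, z ∈ Submodule.span ℝ≥0 ((fun y => (y, (1 : ℝ))) '' s) →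
        0 ≤ z.2 ∧ ∃ y ∈ convexHull ℝ s, z.1 = z.2 • y := by
      intro z hz
      induction hz using Submodule.span_induction with
      | mem z hz =>
        obtain ⟨y, hy, rfl⟩ := hz
        exact ⟨zero_le_one, y, subset_convexHull ℝ s hy, by simp⟩
      | zero =>
        obtain ⟨y, hy⟩ := hs
        exact ⟨le_rfl, y, subset_convexHull ℝ s hy, by simp⟩
      | add z w _ _ hz hw =>
        obtain ⟨hz0, y, hy, hzy⟩ := hz
        obtain ⟨hw0, y', hy', hwy⟩ := hw
        obtain ⟨u, hu, huy⟩ := (convex_convexHull ℝ s).exists_mem_add_smul_eq hy hy' hz0 hw0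
        exact ⟨add_nonneg hz0 hw0, u, hu, by simp [huy, hzy, hwy]⟩
      | smul c z _ hz =>
        obtain ⟨hz0, y, hy, hzy⟩ := hz
        exact ⟨mul_nonneg c.2 hz0, y, hy, by simp [hzy, NNReal.smul_def, mul_smul]⟩
    obtain ⟨-, y, hy, hxy⟩ := key _ hx
    simp only [one_smul] at hxy
    rwa [hxy]

end MinkowskiWeyl

variable {E : Type*} [NormedAddCommGroup E] [InnerProductSpace ℝ E] [FiniteDimensional ℝ E]

/-- A polytope is the intersection of finitely many supporting half-spaces with unit normals. -/
theorem exists_finset_convexHull_eq {s : Set E} (hs : s.Finite) (hne : s.Nonempty) :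
    ∃ A : Finset E, (∀ a ∈ A, ‖a‖ = 1) ∧ ∀ x, x ∈ convexHull ℝ s ↔
      ∀ a ∈ A, ⟪a, x⟫ ≤ sSup ((fun y => ⟪a, y⟫) '' convexHull ℝ s) := by
  classical
  obtain ⟨T, hT⟩ := exists_mem_span_nnreal_iff
    (hs.toFinset.image (fun y => (y, (1 : ℝ))))
  rw [Finset.coe_image, Finite.coe_toFinset] at hT
  have hT' : ∀ x, x ∈ convexHull ℝ s ↔ ∀ f ∈ T, 0 ≤ f (x, (1 : ℝ)) := fun x => by
    rw [mem_convexHull_iff_mem_span hne, hT]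
  let n : Module.Dual ℝ (E × ℝ) → E := fun f =>
    -(InnerProductSpace.toDual ℝ E).symm
      (LinearMap.toContinuousLinearMap (f ∘ₗ LinearMap.inl ℝ E ℝ))
  have hn : ∀ f x, ⟪n f, x⟫ = - f (x, 0) := fun f x => by simp [n]
  have hf : ∀ (f : Module.Dual ℝ (E × ℝ)) (x : E), f (x, (1 : ℝ)) = f (0, 1) - ⟪n f, x⟫ :=
    fun f x => by rw [hn, sub_neg_eq_add, ← map_add]; simp
  have hbdd : ∀ a : E, BddAbove ((fun y => ⟪a, y⟫) '' convexHull ℝ s) := fun a =>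
    (hs.isCompact_convexHull (𝕜 := ℝ)).bddAbove_image (by fun_prop)
  have hne' : (convexHull ℝ s).Nonempty := hne.convexHull
  refine ⟨(T.filter (fun f => n f ≠ 0)).image (fun f => ‖n f‖⁻¹ • n f), ?_, fun x => ⟨?_, ?_⟩⟩
  · intro a ha
    obtain ⟨f, hf, rfl⟩ := Finset.mem_image.1 ha
    exact norm_smul_inv_norm (𝕜 := ℝ) (Finset.mem_filter.1 hf).2
  · intro hx a _
    exact le_csSup (hbdd a) (mem_image_of_mem _ hx)
  · intro h
    refine (hT' x).2 fun f hfT => ?_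
    rw [hf]
    -- With zero normal, `f` is constant on the slice at height one, so one point of the hull
    -- decides its sign.
    by_cases h0 : n f = 0
    · obtain ⟨y, hy⟩ := hne'
      have := (hT' y).1 hy f hfT
      rw [hf] at this
      simpa [h0] using this
    · have h1 := h _ (Finset.mem_image.2 ⟨f, Finset.mem_filter.2 ⟨hfT, h0⟩, rfl⟩)
      have hpos : 0 < ‖n f‖⁻¹ := inv_pos.2 (norm_pos_iff.2 h0)
      have h2 : sSup ((fun y => ⟪‖n f‖⁻¹ • n f, y⟫) '' convexHull ℝ s) ≤ ‖n f‖⁻¹ * f (0, 1) := by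
        refine csSup_le (hne'.image _) ?_
        rintro _ ⟨y, hy, rfl⟩
        have := (hT' y).1 hy f hfT
        rw [hf] at this
        simp only [real_inner_smul_left]
        exact mul_le_mul_of_nonneg_left (by linarith) hpos.le
      rw [real_inner_smul_left] at h1
      have := le_of_mul_le_mul_left (h1.trans h2) hpos
      linarith

end InnerNeighbourhood

end

/-! ### Layers of cells: concavity and differentiability of their volume. -/

noncomputable section

namespace InnerNeighbourhood

open Filter Topology
open scoped RealInnerProductSpace

variable {E : Type*} [NormedAddCommGroup E] [InnerProductSpace ℝ E]

/-- The signed distance from `x` to the hyperplane `⟪a, ·⟫ = b a`, for a unit normal `a`. -/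
def gap (b : E → ℝ) (a x : E) : ℝ := b a - ⟪a, x⟫

/-- The points whose nearest facet has normal `a`, at a distance in `(u, v]`. -/
def cell (A : Finset E) (b : E → ℝ) (a : E) (u v : ℝ) : Set E :=
  {x | u < gap b a x ∧ gap b a x ≤ v ∧ ∀ c ∈ A, gap b a x ≤ gap b c x}

/-- The points at a signed distance at least `u` from all facets. -/
def polyhedron (A : Finset E) (b : E → ℝ) (u : ℝ) : Set E :=
  {x | ∀ a ∈ A, u ≤ gap b a x}

variable {A : Finset E} {b : E → ℝ} {a c : E} {u v w : ℝ}

theorem mem_cell {x : E} : x ∈ cell A b a u v ↔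
    u < gap b a x ∧ gap b a x ≤ v ∧ ∀ c ∈ A, gap b a x ≤ gap b c x := Iff.rfl

theorem mem_polyhedron {x : E} : x ∈ polyhedron A b u ↔ ∀ a ∈ A, u ≤ gap b a x := Iff.rfl

theorem gap_add_smul (b : E → ℝ) (c x a : E) (t : ℝ) :
    gap b c (x + t • a) = gap b c x - t * ⟪c, a⟫ := by
  simp only [gap, inner_add_right, real_inner_smul_right]; ring

theorem gap_add_smul_self (b : E → ℝ) (x : E) (ha : ‖a‖ = 1) (t : ℝ) :
    gap b a (x + t • a) = gap b a x - t := by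
  rw [gap_add_smul, real_inner_self_eq_norm_sq, ha]; ring

theorem inner_le_one (hc : ‖c‖ = 1) (ha : ‖a‖ = 1) : ⟪c, a⟫ ≤ 1 := by
  simpa [hc, ha] using real_inner_le_norm c a

theorem continuous_gap (b : E → ℝ) (a : E) : Continuous (gap b a) := by
  unfold gap; fun_prop

theorem cell_subset_polyhedron : cell A b a u v ⊆ polyhedron A b u :=
  fun _ hx c hc => hx.1.le.trans (hx.2.2 c hc)

theorem polyhedron_anti (h : u ≤ v) : polyhedron A b v ⊆ polyhedron A b u :=
  fun _ hx c hc => h.trans (hx c hc)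

theorem cell_union_cell (huv : u ≤ v) (hvw : v ≤ w) :
    cell A b a u v ∪ cell A b a v w = cell A b a u w := by
  ext x
  simp only [mem_union, mem_cell]
  constructor
  · rintro (⟨h1, h2, h3⟩ | ⟨h1, h2, h3⟩)
    · exact ⟨h1, h2.trans hvw, h3⟩
    · exact ⟨huv.trans_lt h1, h2, h3⟩
  · rintro ⟨h1, h2, h3⟩
    rcases le_or_gt (gap b a x) v with h | h
    · exact Or.inl ⟨h1, h, h3⟩
    · exact Or.inr ⟨h, h2, h3⟩

theorem disjoint_cell_cell : Disjoint (cell A b a u v) (cell A b a v w) :=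
  disjoint_left.2 fun _ hx hy => (hy.1.trans_le hx.2.1).false

theorem measurableSet_cell [MeasurableSpace E] [BorelSpace E] : MeasurableSet (cell A b a u v) := by
  have h : cell A b a u v = {x | u < gap b a x} ∩ ({x | gap b a x ≤ v} ∩
      ⋂ c ∈ A, {x | gap b a x ≤ gap b c x}) := by
    ext x; simp [mem_cell]
  rw [h]
  refine (isOpen_lt continuous_const (continuous_gap b a)).measurableSet.inter
    (((isClosed_le (continuous_gap b a) continuous_const).inter
      (isClosed_biInter fun c _ => ?_)).measurableSet)
  exact isClosed_le (continuous_gap b a) (continuous_gap b c)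

variable [MeasurableSpace E] [FiniteDimensional ℝ E] (μ : Measure E) [μ.IsAddHaarMeasure]

theorem measure_cell_ne_top (hb : Bornology.IsBounded (polyhedron A b u)) (huw : u ≤ w) :
    μ (cell A b a w v) ≠ ⊤ :=
  ((hb.subset (cell_subset_polyhedron.trans (polyhedron_anti huw))).measure_lt_top).ne

variable [BorelSpace E]

theorem measure_hyperplane_eq_zero {e : E} (he : e ≠ 0) (β : ℝ) :
    μ {x | ⟪e, x⟫ = β} = 0 := by
  let H : AffineSubspace ℝ E :=
    (AffineSubspace.mk' β (⊥ : Submodule ℝ ℝ)).comap (innerSL ℝ e).toLinearMap.toAffineMap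
  have hmem : ∀ x, x ∈ H ↔ ⟪e, x⟫ = β := fun x => by
    simp [H, sub_eq_zero]
  have hH : H ≠ ⊤ := by
    intro h
    have h0 : (0 : E) ∈ H := h ▸ AffineSubspace.mem_top _ _ _
    have h1 : e ∈ H := h ▸ AffineSubspace.mem_top _ _ _
    rw [hmem] at h0 h1
    rw [inner_zero_right] at h0
    rw [← h0] at h1
    exact he (inner_self_eq_zero.1 h1)
  have := Measure.addHaar_affineSubspace μ H hH
  convert this using 2
  ext x
  exact (hmem x).symm

theorem measure_gap_eq_gap (hac : a ≠ c) : μ {x | gap b a x = gap b c x} = 0 := by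
  have := measure_hyperplane_eq_zero μ (sub_ne_zero.2 hac) (b a - b c)
  convert this using 2
  ext x
  simp only [gap, mem_ofPred_eq, inner_sub_left]
  constructor <;> intro h <;> linarith

theorem aedisjoint_cell (ha : a ∈ A) (hc : c ∈ A) (hac : a ≠ c) :
    AEDisjoint μ (cell A b a u v) (cell A b c u v) :=
  measure_mono_null (fun _ hx => le_antisymm (hx.1.2.2 c hc) (hx.2.2.2 a ha))
    (measure_gap_eq_gap μ (b := b) hac)

theorem measureReal_cell_add (hb : Bornology.IsBounded (polyhedron A b u)) {x y z : ℝ}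
    (hu : u ≤ x) (hxy : x ≤ y) (hyz : y ≤ z) :
    μ.real (cell A b a x z) = μ.real (cell A b a x y) + μ.real (cell A b a y z) := by
  rw [← cell_union_cell hxy hyz, measureReal_union disjoint_cell_cell measurableSet_cell
    (measure_cell_ne_top μ hb hu) (measure_cell_ne_top μ hb (hu.trans hxy))]

/-- Outer cells are at least as thick as inner ones: an affine map that moves points
along the normal `a` sends the inner cell into the outer one. -/
theorem mul_measure_cell_le (hA : ∀ c ∈ A, ‖c‖ = 1) (ha : a ∈ A) {x y z : ℝ} (hxy : x < y)
    (hyz : y < z) :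
    ENNReal.ofReal ((y - x) / (z - y)) * μ (cell A b a y z) ≤ μ (cell A b a x y) := by
  set k := (y - x) / (z - y) with hk
  have hkpos : 0 < k := div_pos (by linarith) (by linarith)
  have hkz : k * (z - y) = y - x := div_mul_cancel₀ _ (by linarith)
  -- The affine map `L + e` moves points along `a` only and turns a gap `s` into `x + (s - y) * k`;
  -- thus (y, z] goes to (x, y], with determinant `k`.
  let L : E →ₗ[ℝ] E := LinearMap.transvection ((-(1 - k)) • (innerSL ℝ a).toLinearMap) a
  have hdet : LinearMap.det L = k := by
    rw [LinearMap.transvection.det]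
    simp [hA a ha]
  let e : E := ((1 - k) * b a + (k * y - x)) • a
  have hLe : ∀ p, L p + e = p + (gap b a p - (x + (gap b a p - y) * k)) • a := by
    intro p
    simp only [L, e, LinearMap.transvection.apply, gap, add_assoc, ← add_smul]
    congr 2
    simp
    ring
  have hmaps : (fun p => p + e) '' (L '' cell A b a y z) ⊆ cell A b a x y := by
    rintro _ ⟨_, ⟨p, ⟨h1, h2, h3⟩, rfl⟩, rfl⟩
    simp only [hLe]
    have hle : (gap b a p - y) * k ≤ y - x := by nlinarith
    have hpos : 0 < (gap b a p - y) * k := mul_pos (by linarith) hkpos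
    rw [mem_cell, gap_add_smul_self b p (hA a ha)]
    refine ⟨by linarith, by linarith, fun c hc => ?_⟩
    rw [gap_add_smul]
    -- The gap to `a` decreases, and the gap to `c` decreases by at most as much because `⟪c, a⟫ ≤
    -- 1`; so `a` stays nearest.
    have := h3 c hc
    nlinarith [inner_le_one (hA c hc) (hA a ha)]
  refine le_trans (le_of_eq ?_) (measure_mono hmaps)
  rw [image_add_right, measure_preimage_add_right, Measure.addHaar_image_linearMap, hdet,
    abs_of_pos hkpos]

/-- The volume of the points of `polyhedron A b (-1)` within signed distance `s` of a facet. -/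
def layerVol (A : Finset E) (b : E → ℝ) (s : ℝ) : ℝ :=
  ∑ a ∈ A, μ.real (cell A b a (-1) s)

theorem layerVol_sub (hb : Bornology.IsBounded (polyhedron A b (-1))) {x y : ℝ}
    (hx : -1 ≤ x) (hxy : x ≤ y) :
    layerVol μ A b y - layerVol μ A b x = ∑ a ∈ A, μ.real (cell A b a x y) := by
  rw [layerVol, layerVol, ← Finset.sum_sub_distrib]
  refine Finset.sum_congr rfl fun a _ => ?_
  rw [measureReal_cell_add μ hb le_rfl hx hxy]
  ring

theorem concaveOn_layerVol (hA : ∀ c ∈ A, ‖c‖ = 1)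
    (hb : Bornology.IsBounded (polyhedron A b (-1))) :
    ConcaveOn ℝ (Ici (-1)) (layerVol μ A b) := by
  refine concaveOn_of_slope_anti_adjacent (convex_Ici _) ?_
  intro x y z hx _ hxy hyz
  have hx : -1 ≤ x := hx
  rw [layerVol_sub μ hb hx hxy.le, layerVol_sub μ hb (hx.trans hxy.le) hyz.le,
    div_le_div_iff₀ (by linarith) (by linarith), Finset.sum_mul, Finset.sum_mul]
  refine Finset.sum_le_sum fun a ha => ?_
  have h := ENNReal.toReal_mono (measure_cell_ne_top μ hb hx)
    (mul_measure_cell_le μ (b := b) hA ha hxy hyz)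
  rw [ENNReal.toReal_mul, ENNReal.toReal_ofReal (div_nonneg (by linarith) (by linarith)),
    div_mul_eq_mul_div, div_le_iff₀ (by linarith)] at h
  simp only [Measure.real]
  linarith

/-- Packing bound: the translates of `S` by the `f i` are disjoint, lie in `G` and have equal
measure. -/
theorem card_mul_measure_le {V ι : Type*} [AddCommGroup V] [MeasurableSpace V] [MeasurableAdd V]
    (μ : Measure V) [μ.IsAddRightInvariant] [Fintype ι] {S G : Set V} (hS : MeasurableSet S)
    (f : ι → V) (hd : Pairwise fun i j => ∀ x ∈ S, ∀ y ∈ S, x + f i ≠ y + f j)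
    (hG : ∀ i, ∀ x ∈ S, x + f i ∈ G) :
    Fintype.card ι * μ S ≤ μ G := by
  have h : μ (⋃ i, (fun x => x + -f i) ⁻¹' S) = Fintype.card ι * μ S := by
    rw [measure_iUnion, tsum_fintype]
    · simp [measure_preimage_add_right]
    · intro i j hij
      refine disjoint_left.2 fun x hx hy => hd hij _ hx _ hy ?_
      simp
    · exact fun i => (measurable_add_const _) hS
  rw [← h]
  refine measure_mono (iUnion_subset fun i x hx => ?_)
  simpa using hG i _ hx

/-- The intersection of two non-parallel slabs of width `O(h)` has volume `O(h²)`
in any bounded region. -/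
theorem exists_measureReal_two_slabs_le (ha : ‖a‖ = 1) (hc : ‖c‖ = 1) (hac : a ≠ c)
    (hac' : c ≠ -a) (R : ℝ) :
    ∃ C : ℝ, ∀ h, 0 < h → h ≤ 1 → ∀ α β : ℝ,
      μ.real {x | ‖x‖ ≤ R ∧ |⟪a, x⟫ - α| ≤ h ∧ |⟪c, x⟫ - β| ≤ h} ≤ C * h ^ 2 := by
  set q := ⟪a, c⟫ with hq
  have hq1 : q < 1 := inner_lt_one_iff_real_of_norm_eq_one ha hc |>.2 hac
  have hq2 : -1 < q := by
    have : ⟪a, -c⟫ < 1 := (inner_lt_one_iff_real_of_norm_eq_one ha (by simpa using hc)).2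
      fun h => hac' (by simp [h])
    rw [inner_neg_right] at this
    linarith
  have hD : 0 < 1 - q ^ 2 := by nlinarith
  -- `p`, `r` form the basis dual to `a`, `c` in their span: moving along one leaves the other slab
  -- coordinate fixed.
  let p : E := (1 - q ^ 2)⁻¹ • (a - q • c)
  let r : E := (1 - q ^ 2)⁻¹ • (c - q • a)
  have haa : ⟪a, a⟫ = 1 := by rw [real_inner_self_eq_norm_sq, ha]; norm_num
  have hcc : ⟪c, c⟫ = 1 := by rw [real_inner_self_eq_norm_sq, hc]; norm_num
  have hca : ⟪c, a⟫ = q := by rw [real_inner_comm]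
  have hap : ⟪a, p⟫ = 1 := by
    simp only [p, real_inner_smul_right, inner_sub_right, haa, ← hq]
    field_simp
  have hcp : ⟪c, p⟫ = 0 := by
    simp only [p, real_inner_smul_right, inner_sub_right, hcc, hca]
    ring
  have har : ⟪a, r⟫ = 0 := by
    simp only [r, real_inner_smul_right, inner_sub_right, haa, ← hq]
    ring
  have hcr : ⟪c, r⟫ = 1 := by
    simp only [r, real_inner_smul_right, inner_sub_right, hcc, hca]
    field_simp
  set G : Set E := Metric.closedBall 0 (R + 6 * ‖p‖ + 6 * ‖r‖) with hG
  have hGfin : μ G ≠ ⊤ := measure_closedBall_lt_top.ne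
  refine ⟨μ.real G, fun h h0 h1 α β => ?_⟩
  set S : Set E := {x | ‖x‖ ≤ R ∧ |⟪a, x⟫ - α| ≤ h ∧ |⟪c, x⟫ - β| ≤ h} with hS
  have hSm : MeasurableSet S := by
    have h3 : S = {x | ‖x‖ ≤ R} ∩ ({x | |⟪a, x⟫ - α| ≤ h} ∩ {x | |⟪c, x⟫ - β| ≤ h}) := rfl
    rw [h3]
    exact ((isClosed_le (by fun_prop) (by fun_prop)).inter
      ((isClosed_le (by fun_prop) (by fun_prop)).inter
        (isClosed_le (by fun_prop) (by fun_prop)))).measurableSet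
  -- Slabs have width `2 * h`, so steps of `3 * h` separate the translates. As `1 ≤ N * h ≤ 2`,
  -- there are at least h⁻² of them, and each shift is at most 6 in either direction, inside a fixed
  -- ball.
  set N := ⌈1 / h⌉₊ with hN
  have hNh : 1 ≤ N * h := by
    have := Nat.le_ceil (1 / h)
    rwa [div_le_iff₀ h0] at this
  have hNh' : N * h ≤ 2 := by
    have := Nat.ceil_lt_add_one (one_div_nonneg.2 h0.le)
    have h2 : (1 / h + 1) * h = 1 + h := by field_simp
    nlinarith
  have hstep : ∀ i : Fin N, 3 * h * (i : ℝ) ≤ 6 := fun i => by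
    have : ((i : ℕ) : ℝ) ≤ N := by exact_mod_cast i.2.le
    nlinarith
  have hsep : ∀ (i j : ℕ) (X Y γ : ℝ), |X - γ| ≤ h → |Y - γ| ≤ h →
      X + 3 * h * i = Y + 3 * h * j → i = j := by
    intro i j X Y γ hX hY hXY
    rw [abs_le] at hX hY
    by_contra hij
    rcases lt_or_gt_of_ne hij with hij | hij
    · have : (i : ℝ) + 1 ≤ j := by exact_mod_cast hij
      nlinarith
    · have : (j : ℝ) + 1 ≤ i := by exact_mod_cast hij
      nlinarith
  have hcard := card_mul_measure_le μ (S := S) (G := G) hSm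
    (fun i : Fin N × Fin N => (3 * h * (i.1 : ℝ)) • p + (3 * h * (i.2 : ℝ)) • r) ?_ ?_
  · have h2 := ENNReal.toReal_mono hGfin hcard
    simp only [Fintype.card_prod, Fintype.card_fin, ENNReal.toReal_mul, Nat.cast_mul,
      ENNReal.toReal_natCast] at h2
    change (N : ℝ) * N * μ.real S ≤ μ.real G at h2
    have hSn : 0 ≤ μ.real S := measureReal_nonneg
    calc μ.real S ≤ (N * h) * (N * h) * μ.real S :=
          le_mul_of_one_le_left hSn (by nlinarith)
      _ = (N * N * μ.real S) * h ^ 2 := by ring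
      _ ≤ μ.real G * h ^ 2 := by gcongr
  · intro i j hij x hx y hy hxy
    apply hij
    have e1 := congrArg (fun z => ⟪a, z⟫) hxy
    have e2 := congrArg (fun z => ⟪c, z⟫) hxy
    simp only [inner_add_right, real_inner_smul_right, hap, har, hcp, hcr, mul_one, mul_zero,
      add_zero, zero_add] at e1 e2
    exact Prod.ext (Fin.ext (hsep _ _ _ _ α hx.2.1 hy.2.1 e1))
      (Fin.ext (hsep _ _ _ _ β hx.2.2 hy.2.2 e2))
  · intro i x hx
    rw [hG, mem_closedBall_zero_iff]
    have n1 : ‖(3 * h * (i.1 : ℝ)) • p‖ ≤ 6 * ‖p‖ := by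
      rw [norm_smul, Real.norm_of_nonneg (by positivity)]
      exact mul_le_mul_of_nonneg_right (hstep _) (norm_nonneg _)
    have n2 : ‖(3 * h * (i.2 : ℝ)) • r‖ ≤ 6 * ‖r‖ := by
      rw [norm_smul, Real.norm_of_nonneg (by positivity)]
      exact mul_le_mul_of_nonneg_right (hstep _) (norm_nonneg _)
    have := norm_add_le x ((3 * h * (i.1 : ℝ)) • p + (3 * h * (i.2 : ℝ)) • r)
    have := norm_add_le ((3 * h * (i.1 : ℝ)) • p) ((3 * h * (i.2 : ℝ)) • r)
    linarith [hx.1]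

/-- The points of a thin cell that are close to a second facet have volume `O(h²)`. -/
theorem exists_measureReal_near_second_facet_le (hA : ∀ c ∈ A, ‖c‖ = 1)
    (hb : Bornology.IsBounded (polyhedron A b (-1))) (ha : a ∈ A) (hc : c ∈ A) (hac : a ≠ c)
    {t r : ℝ} (ht : -1 < t) (htr : t < r) {p : E} (hp : p ∈ polyhedron A b r) :
    ∃ C : ℝ, ∀ᶠ h in 𝓝[>] (0 : ℝ),
      μ.real {x | x ∈ cell A b a (t - h) t ∧ gap b c x < gap b a x + 2 * h} ≤ C * h ^ 2 := by
  by_cases hac' : c = -a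
  · refine ⟨0, ?_⟩
    filter_upwards [Ioo_mem_nhdsGT (sub_pos.2 htr)] with h hh
    -- For opposite normals the two gaps have constant sum, at least `2 * r` by `p`; in this set the
    -- sum would be below `2 * t + 2 * h`, which is less than `2 * r`.
    have : {x | x ∈ cell A b a (t - h) t ∧ gap b c x < gap b a x + 2 * h} = ∅ := by
      refine eq_empty_of_forall_notMem fun x hx => ?_
      have h1 := hp a ha
      have h2 := hp c hc
      have h3 := hx.2
      have h4 := hx.1.2.1
      have h5 := hh.2
      simp only [gap, hac', inner_neg_left] at h1 h2 h3 h4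
      linarith
    simp [this]
  · obtain ⟨R, hR⟩ := hb.subset_closedBall 0
    obtain ⟨C, hC⟩ := exists_measureReal_two_slabs_le μ (hA a ha) (hA c hc) hac hac' R
    -- Both gaps lie within `2 * h` of `t`, hence the factor 4 = 2².
    refine ⟨C * 4, ?_⟩
    filter_upwards [Ioo_mem_nhdsGT (sub_pos.2 ht), Ioo_mem_nhdsGT (one_half_pos (α := ℝ))]
      with h hh hh'
    have h0 : 0 < h := hh.1
    have := hC (2 * h) (by linarith) (by linarith [hh'.2]) (b a - t) (b c - t)
    refine (measureReal_mono ?_ ?_).trans (this.trans_eq (by ring))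
    · rintro x ⟨hx, hxc⟩
      have h1 := hx.1
      have h2 := hx.2.1
      have h3 := hx.2.2 c hc
      have hxb : x ∈ polyhedron A b (-1) :=
        polyhedron_anti (by linarith [hh.2]) (cell_subset_polyhedron hx)
      simp only [gap] at h1 h2 h3 hxc
      refine ⟨by simpa using hR hxb, abs_le.2 ⟨?_, ?_⟩, abs_le.2 ⟨?_, ?_⟩⟩ <;> linarith
    · refine ((Metric.isBounded_closedBall (x := (0 : E)) (r := R)).subset ?_).measure_lt_top.ne
      intro x hx
      simpa using hx.1

/-- Translating by `-(h • a)` raises the gap to `a` by `h` and lowers any other by at most `h`. So a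
lead of `2 * h` over every other facet keeps `a` nearest, and only the O(h²) sets near a second
facet are lost. -/
theorem exists_measureReal_cell_le (hA : ∀ c ∈ A, ‖c‖ = 1)
    (hb : Bornology.IsBounded (polyhedron A b (-1))) (ha : a ∈ A)
    {t r : ℝ} (ht : -1 < t) (htr : t < r) {p : E} (hp : p ∈ polyhedron A b r) :
    ∃ C : ℝ, ∀ᶠ h in 𝓝[>] (0 : ℝ),
      μ.real (cell A b a (t - h) t) ≤ μ.real (cell A b a t (t + h)) + C * h ^ 2 := by
  classical
  have hex : ∀ c ∈ A.erase a, ∃ C : ℝ, ∀ᶠ h in 𝓝[>] (0 : ℝ),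
      μ.real {x | x ∈ cell A b a (t - h) t ∧ gap b c x < gap b a x + 2 * h} ≤ C * h ^ 2 :=
    fun c hc => exists_measureReal_near_second_facet_le μ hA hb ha (Finset.mem_of_mem_erase hc)
      (Finset.ne_of_mem_erase hc).symm ht htr hp
  choose! C hC using hex
  refine ⟨∑ c ∈ A.erase a, C c, ?_⟩
  filter_upwards [(Filter.eventually_all_finset _).2 hC, Ioo_mem_nhdsGT (sub_pos.2 ht)]
    with h hh hh1
  have h0 : 0 < h := hh1.1
  set B : E → Set E := fun c =>
    {x | x ∈ cell A b a (t - h) t ∧ gap b c x < gap b a x + 2 * h} with hB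
  have hsub : cell A b a (t - h) t ⊆
      (fun x => x + -(h • a)) ⁻¹' cell A b a t (t + h) ∪ ⋃ c ∈ A.erase a, B c := by
    intro x hx
    by_cases hxB : ∃ c ∈ A.erase a, x ∈ B c
    · exact Or.inr (by simpa only [mem_iUnion₂, exists_prop] using hxB)
    · refine Or.inl ?_
      rw [mem_preimage, ← neg_smul, mem_cell, gap_add_smul_self b x (hA a ha)]
      refine ⟨by linarith [hx.1], by linarith [hx.2.1], fun c hc => ?_⟩
      by_cases hca : c = a
      · rw [hca, gap_add_smul_self b x (hA a ha)]
      · have h1 : gap b a x + 2 * h ≤ gap b c x := by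
          by_contra hlt
          exact hxB ⟨c, Finset.mem_erase.2 ⟨hca, hc⟩, hx, not_le.1 hlt⟩
        have h2 : -1 ≤ ⟪c, a⟫ := by
          have := inner_le_one (c := -c) (by simpa using hA c hc) (hA a ha)
          rw [inner_neg_left] at this
          linarith
        rw [gap_add_smul]
        nlinarith
  have hBfin : ∀ c, μ (B c) ≠ ⊤ := fun c =>
    ne_top_of_le_ne_top (measure_cell_ne_top μ hb (by linarith [hh1.2]))
      (measure_mono fun _ hx => hx.1)
  have hpre : μ ((fun x => x + -(h • a)) ⁻¹' cell A b a t (t + h)) =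
    μ (cell A b a t (t + h)) := measure_preimage_add_right _ _ _
  have hUfin : μ (⋃ c ∈ A.erase a, B c) ≠ ⊤ :=
    ((measure_biUnion_lt_top (A.erase a).finite_toSet fun c _ => (hBfin c).lt_top)).ne
  calc μ.real (cell A b a (t - h) t)
      ≤ μ.real ((fun x => x + -(h • a)) ⁻¹' cell A b a t (t + h) ∪ ⋃ c ∈ A.erase a, B c) := by
        refine measureReal_mono hsub (measure_union_ne_top ?_ hUfin)
        rw [hpre]
        exact measure_cell_ne_top μ hb ht.le
    _ ≤ μ.real ((fun x => x + -(h • a)) ⁻¹' cell A b a t (t + h)) +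
          μ.real (⋃ c ∈ A.erase a, B c) := measureReal_union_le _ _
    _ ≤ μ.real (cell A b a t (t + h)) + ∑ c ∈ A.erase a, μ.real (B c) := by
        refine add_le_add (le_of_eq ?_) (measureReal_biUnion_finset_le _ _)
        rw [Measure.real, hpre, Measure.real]
    _ ≤ _ := by
        rw [Finset.sum_mul]
        gcongr with c hc
        exact hh c hc

theorem differentiableAt_layerVol (hA : ∀ c ∈ A, ‖c‖ = 1)
    (hb : Bornology.IsBounded (polyhedron A b (-1)))
    {t r : ℝ} (ht : -1 < t) (htr : t < r) {p : E} (hp : p ∈ polyhedron A b r) :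
    DifferentiableAt ℝ (layerVol μ A b) t := by
  have hex : ∀ a ∈ A, ∃ C : ℝ, ∀ᶠ h in 𝓝[>] (0 : ℝ),
      μ.real (cell A b a (t - h) t) ≤ μ.real (cell A b a t (t + h)) + C * h ^ 2 :=
    fun a ha => exists_measureReal_cell_le μ hA hb ha ht htr hp
  choose! C hC using hex
  refine differentiableAt_of_concaveOn_of_second_difference (C := ∑ a ∈ A, C a)
    (concaveOn_layerVol μ hA hb) (by simpa using ht) ?_
  filter_upwards [(Filter.eventually_all_finset _).2 hC, Ioo_mem_nhdsGT (sub_pos.2 ht)]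
    with h hh hh1
  rw [layerVol_sub μ hb (by linarith [hh1.2]) (by linarith [hh1.1]),
    layerVol_sub μ hb ht.le (by linarith [hh1.1]), Finset.sum_mul, ← Finset.sum_add_distrib]
  exact Finset.sum_le_sum hh

end InnerNeighbourhood

end

/-! ### From polyhedra to inner neighbourhoods and the inradius. -/

noncomputable section

namespace InnerNeighbourhood

open Filter Topology
open scoped RealInnerProductSpace

section Geometry

variable {E : Type*} [NormedAddCommGroup E] [InnerProductSpace ℝ E]
  {A : Finset E} {b : E → ℝ} {a : E}

theorem gap_sub_le (b : E → ℝ) (ha : ‖a‖ = 1) (x y : E) :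
    gap b a x - ‖x - y‖ ≤ gap b a y := by
  have h := real_inner_le_norm a (y - x)
  rw [ha, one_mul, inner_sub_right, norm_sub_rev] at h
  simp only [gap]
  linarith

theorem closedBall_subset_polyhedron_iff (hA : ∀ c ∈ A, ‖c‖ = 1) {x : E} {r : ℝ} (hr : 0 ≤ r) :
    Metric.closedBall x r ⊆ polyhedron A b 0 ↔ x ∈ polyhedron A b r := by
  constructor
  · intro h a ha
    have hy : x + r • a ∈ Metric.closedBall x r := by
      simp [norm_smul, hA a ha, abs_of_nonneg hr]
    have := h hy a ha
    rw [gap_add_smul_self b x (hA a ha)] at this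
    linarith
  · intro h y hy a ha
    have h1 := gap_sub_le b (hA a ha) x y
    rw [mem_closedBall_iff_norm'] at hy
    linarith [h a ha]

theorem exists_mem_frontier_polyhedron_iff (hA : ∀ c ∈ A, ‖c‖ = 1) {x : E}
    (hx : x ∈ polyhedron A b 0) (ε : ℝ) :
    (∃ y ∈ frontier (polyhedron A b 0), ‖x - y‖ ≤ ε) ↔ ∃ a ∈ A, gap b a x ≤ ε := by
  constructor
  · rintro ⟨y, hy, hxy⟩
    by_contra! h
    have hopen : IsOpen (⋂ a ∈ A, {z | 0 < gap b a z}) :=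
      isOpen_biInter_finset fun a _ => isOpen_lt continuous_const (continuous_gap b a)
    have hsub : (⋂ a ∈ A, {z | 0 < gap b a z}) ⊆ polyhedron A b 0 := fun z hz a ha =>
      (mem_iInter₂.1 hz a ha).le
    refine hy.2 (interior_maximal hsub hopen (mem_iInter₂.2 fun a ha => ?_))
    have := gap_sub_le b (hA a ha) x y
    have := h a ha
    change 0 < gap b a y
    linarith
  · rintro ⟨c, hc, hcx⟩
    obtain ⟨a, ha, hmin⟩ := A.exists_min_image (fun a => gap b a x) ⟨c, hc⟩
    have h0 : 0 ≤ gap b a x := hx a ha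
    -- The foot of the perpendicular to the nearest facet hyperplane. It stays in the polyhedron
    -- since no other gap shrinks faster; any further push along `a` leaves it.
    set y := x + gap b a x • a with hy
    refine ⟨y, ⟨subset_closure fun d hd => ?_, fun hint => ?_⟩, ?_⟩
    · rw [hy, gap_add_smul]
      nlinarith [hmin d hd, inner_le_one (hA d hd) (hA a ha)]
    · obtain ⟨δ, hδ, hball⟩ := Metric.isOpen_iff.1 isOpen_interior y hint
      have hz : y + (δ / 2) • a ∈ Metric.ball y δ := by
        rw [mem_ball_iff_norm, add_sub_cancel_left, norm_smul, hA a ha,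
          Real.norm_of_nonneg (by positivity)]
        linarith
      have := interior_subset (hball hz) a ha
      rw [gap_add_smul_self b y (hA a ha), hy, gap_add_smul_self b x (hA a ha)] at this
      linarith
    · rw [hy, sub_add_cancel_left, norm_neg, norm_smul, hA a ha, Real.norm_of_nonneg h0, mul_one]
      exact (hmin c hc).trans hcx

/-- The homothety centred at `p` with ratio `ρ / (1 + ρ)` maps the enlarged polyhedron into the
original: its gaps are at least `(ρ - ρ) / (1 + ρ) = 0`. -/
theorem isBounded_polyhedron_neg_one (hb : Bornology.IsBounded (polyhedron A b 0)) {p : E} {ρ : ℝ}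
    (hρ : 0 < ρ) (hp : p ∈ polyhedron A b ρ) : Bornology.IsBounded (polyhedron A b (-1)) := by
  obtain ⟨R, hR⟩ := hb.subset_closedBall p
  refine Metric.isBounded_closedBall.subset (t := Metric.closedBall p (R / (ρ / (1 + ρ)))) ?_
  intro x hx
  have hs : 0 < ρ / (1 + ρ) := by positivity
  have hmem : p + (ρ / (1 + ρ)) • (x - p) ∈ polyhedron A b 0 := by
    intro a ha
    have e : gap b a (p + (ρ / (1 + ρ)) • (x - p)) =
        (gap b a p + ρ * gap b a x) / (1 + ρ) := by
      simp only [gap, inner_add_right, real_inner_smul_right, inner_sub_right]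
      field_simp
      ring
    rw [e]
    have h1 := hx a ha
    have h2 := hp a ha
    exact div_nonneg (by nlinarith) (by positivity)
  have h := hR hmem
  rw [mem_closedBall_iff_norm, add_sub_cancel_left, norm_smul, Real.norm_of_nonneg hs.le] at h
  rw [mem_closedBall_iff_norm, le_div_iff₀ hs]
  linarith

theorem exists_gt_mem_polyhedron {x : E} {t : ℝ} (h : ∀ a ∈ A, t < gap b a x) :
    ∃ r, t < r ∧ x ∈ polyhedron A b r := by
  have h1 : ∀ᶠ r in 𝓝[>] t, ∀ a ∈ A, r ≤ gap b a x :=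
    (Filter.eventually_all_finset _).2 fun a ha =>
      mem_nhdsWithin_of_mem_nhds (Iic_mem_nhds (h a ha))
  obtain ⟨r, hr, hrt⟩ := (h1.and self_mem_nhdsWithin).exists
  exact ⟨r, hrt, hr⟩

end Geometry

section EuclideanSpace

variable {n : ℕ} {A : Finset (EuclideanSpace ℝ (Fin n))} {b : EuclideanSpace ℝ (Fin n) → ℝ}

theorem IsPolytope.exists_eq_polyhedron {Ω : Set (EuclideanSpace ℝ (Fin n))}
    (hΩ : IsPolytope Ω) :
    ∃ (A : Finset (EuclideanSpace ℝ (Fin n))) (b : EuclideanSpace ℝ (Fin n) → ℝ),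
      (∀ a ∈ A, ‖a‖ = 1) ∧ Ω = polyhedron A b 0 := by
  obtain ⟨s, hs, rfl⟩ := hΩ.exists_finite
  have hne : s.Nonempty := convexHull_nonempty_iff.1 (hΩ.interior_nonempty.mono interior_subset)
  obtain ⟨A, hA, h⟩ := exists_finset_convexHull_eq hs hne
  refine ⟨A, fun a => sSup ((fun y => ⟪a, y⟫) '' convexHull ℝ s), hA, ?_⟩
  ext x
  simp [h, mem_polyhedron, gap]

theorem IsPolytope.isBounded {Ω : Set (EuclideanSpace ℝ (Fin n))} (hΩ : IsPolytope Ω) :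
    Bornology.IsBounded Ω := by
  obtain ⟨s, hs, rfl⟩ := hΩ.exists_finite
  exact isBounded_convexHull.2 hs.isBounded

theorem mem_innerNhd_polyhedron (hA : ∀ a ∈ A, ‖a‖ = 1) {x : EuclideanSpace ℝ (Fin n)} {ε : ℝ} :
    x ∈ innerNhd (polyhedron A b 0) ε ↔ x ∈ polyhedron A b 0 ∧ ∃ a ∈ A, gap b a x ≤ ε :=
  and_congr_right fun hx => exists_mem_frontier_polyhedron_iff hA hx ε

/-- The cells are open at gap 0, so their union misses only points on finitely many facet
hyperplanes, a null set; overlaps of cells are null as well. -/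
theorem vol_innerNhd_polyhedron (hA : ∀ a ∈ A, ‖a‖ = 1)
    (hb : Bornology.IsBounded (polyhedron A b (-1))) {ε : ℝ} (hε : 0 ≤ ε) :
    vol (innerNhd (polyhedron A b 0) ε) =
      layerVol volume A b ε - layerVol volume A b 0 := by
  rw [layerVol_sub volume hb (by norm_num) hε]
  have hae : (innerNhd (polyhedron A b 0) ε : Set _) =ᵐ[volume] ⋃ a ∈ A, cell A b a 0 ε := by
    have hnull : volume (⋃ a ∈ A, {x : EuclideanSpace ℝ (Fin n) | gap b a x = 0}) = 0 := by
      refine (measure_biUnion_null_iff A.countable_toSet).2 fun a ha => ?_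
      have hne : a ≠ 0 := fun h => by simpa [h] using hA a ha
      convert measure_hyperplane_eq_zero volume hne (b a) using 2
      ext x
      simp only [gap, mem_ofPred_eq, sub_eq_zero]
      exact eq_comm
    have hsub : (⋃ a ∈ A, cell A b a 0 ε) ⊆ innerNhd (polyhedron A b 0) ε := by
      refine iUnion₂_subset fun a ha x hx => (mem_innerNhd_polyhedron hA).2
        ⟨cell_subset_polyhedron hx, a, ha, hx.2.1⟩
    refine (ae_le_set.2 (measure_mono_null ?_ hnull)).antisymm hsub.eventuallyLE
    rintro x ⟨hx, hxc⟩
    obtain ⟨hx0, c, hc, hcx⟩ := (mem_innerNhd_polyhedron hA).1 hx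
    obtain ⟨a, ha, hmin⟩ := A.exists_min_image (fun a => gap b a x) ⟨c, hc⟩
    refine mem_iUnion₂.2 ⟨a, ha, le_antisymm ?_ (hx0 a ha)⟩
    by_contra! hpos
    exact hxc (mem_iUnion₂.2 ⟨a, ha, hpos, (hmin c hc).trans hcx, hmin⟩)
  rw [vol, measure_congr hae, measure_biUnion_finset₀
    (fun a ha c hc hac => aedisjoint_cell volume ha hc hac)
    (fun a _ => measurableSet_cell.nullMeasurableSet),
    ENNReal.toReal_sum fun a _ => measure_cell_ne_top volume hb (by norm_num)]
  rfl

/-- A unit vector supplies diameters of length `2 * r`. In dimension zero every radius would be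
admissible. -/
theorem bddAbove_inradius (hn : 1 ≤ n) {Ω : Set (EuclideanSpace ℝ (Fin n))}
    (hb : Bornology.IsBounded Ω) :
    BddAbove {r : ℝ | 0 ≤ r ∧ ∃ x, Metric.closedBall x r ⊆ Ω} := by
  obtain ⟨R, hR⟩ := hb.subset_closedBall 0
  have : Nonempty (Fin n) := ⟨⟨0, hn⟩⟩
  obtain ⟨e, he⟩ := exists_norm_eq (EuclideanSpace ℝ (Fin n)) zero_le_one
  refine ⟨R, ?_⟩
  rintro r ⟨hr, x, hx⟩
  have h1 : x + r • e ∈ Metric.closedBall x r := by simp [norm_smul, he, abs_of_nonneg hr]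
  have h2 : x - r • e ∈ Metric.closedBall x r := by
    simp [norm_smul, he, abs_of_nonneg hr]
  have h1 := hR (hx h1)
  have h2 := hR (hx h2)
  rw [mem_closedBall_zero_iff] at h1 h2
  have h3 := norm_sub_le (x + r • e) (x - r • e)
  have h4 : x + r • e - (x - r • e) = (2 * r) • e := by module
  rw [h4, norm_smul, he, Real.norm_of_nonneg (by positivity)] at h3
  linarith

theorem IsPolytope.inradius_pos (hn : 1 ≤ n) {Ω : Set (EuclideanSpace ℝ (Fin n))}
    (hΩ : IsPolytope Ω) : 0 < inradius Ω := by
  obtain ⟨x, hx⟩ := hΩ.interior_nonempty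
  obtain ⟨r, hr, hball⟩ := Metric.nhds_basis_closedBall.mem_iff.1 (mem_interior_iff_mem_nhds.1 hx)
  exact hr.trans_le (le_csSup (bddAbove_inradius hn hΩ.isBounded) ⟨hr.le, x, hball⟩)

theorem exists_mem_polyhedron_of_lt_inradius (hA : ∀ a ∈ A, ‖a‖ = 1) {t : ℝ}
    (hne : (polyhedron A b 0).Nonempty) (ht : t < inradius (polyhedron A b 0)) :
    ∃ r, t < r ∧ ∃ p, p ∈ polyhedron A b r := by
  obtain ⟨x, hx⟩ := hne
  obtain ⟨r, ⟨hr, p, hp⟩, htr⟩ := exists_lt_of_lt_csSup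
    (⟨0, le_rfl, x, by simpa using hx⟩ :
      {r : ℝ | 0 ≤ r ∧ ∃ x, Metric.closedBall x r ⊆ polyhedron A b 0}.Nonempty) ht
  exact ⟨r, htr, p, (closedBall_subset_polyhedron_iff hA hr).1 hp⟩

/-- A point farther than the inradius from all of the finitely many facets would be the centre of a
larger ball. -/
theorem innerNhd_inradius (hn : 1 ≤ n) (hA : ∀ a ∈ A, ‖a‖ = 1)
    (hb : Bornology.IsBounded (polyhedron A b 0)) (h0 : 0 ≤ inradius (polyhedron A b 0)) :
    innerNhd (polyhedron A b 0) (inradius (polyhedron A b 0)) = polyhedron A b 0 := by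
  refine Subset.antisymm (fun x hx => hx.1) fun x hx => ?_
  refine (mem_innerNhd_polyhedron hA).2 ⟨hx, ?_⟩
  by_contra! h
  obtain ⟨r, hr, hxr⟩ := exists_gt_mem_polyhedron h
  have hr0 := h0.trans hr.le
  exact hr.not_ge (le_csSup (bddAbove_inradius hn hb)
    ⟨hr0, x, (closedBall_subset_polyhedron_iff hA hr0).2 hxr⟩)

theorem differentiableOn_layerVol (hA : ∀ a ∈ A, ‖a‖ = 1)
    (hb : Bornology.IsBounded (polyhedron A b (-1))) (hne : (polyhedron A b 0).Nonempty) :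
    DifferentiableOn ℝ (layerVol volume A b) (Icc 0 (inradius (polyhedron A b 0))) := by
  intro t ht
  rcases ht.2.lt_or_eq with hlt | heq
  · obtain ⟨r, htr, p, hp⟩ := exists_mem_polyhedron_of_lt_inradius hA hne hlt
    exact (differentiableAt_layerVol volume hA hb (by linarith [ht.1]) htr
      hp).differentiableWithinAt
  -- At the inradius the interval lies to the left of `t`, so the left derivative of a concave
  -- function at an interior point of its domain suffices.
  · have hint : t ∈ interior (Ici (-1 : ℝ)) := by
      rw [interior_Ici]
      exact lt_of_lt_of_le (by norm_num) ht.1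
    have h := ((concaveOn_layerVol volume hA hb).neg.hasDerivWithinAt_leftDeriv_of_mem_interior
      hint).Iic_of_Iio.neg.differentiableWithinAt
    rw [neg_neg] at h
    exact h.mono fun s hs => hs.2.trans heq.ge

/-- Bernoulli: (1 - s)ⁿ ≥ 1 - ns for s = ε / In(Ω) ≤ 1. -/
theorem g_div_le (hn : 1 ≤ n) {Ω : Set (EuclideanSpace ℝ (Fin n))} (h0 : 0 < inradius Ω) {ε : ℝ}
    (hε : ε ≤ inradius Ω) : g Ω ε / n ≤ ε * (vol Ω / inradius Ω) := by
  have hs : ε / inradius Ω ≤ 1 := (div_le_one h0).2 hε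
  have hb := one_add_mul_le_pow (a := -(ε / inradius Ω)) (by linarith) n
  have hv : 0 ≤ vol Ω := ENNReal.toReal_nonneg
  have hn' : (0 : ℝ) < n := by exact_mod_cast hn
  rw [g, max_eq_right (by linarith), div_le_iff₀ hn']
  have e : ε * (vol Ω / inradius Ω) * n = vol Ω * (n * (ε / inradius Ω)) := by ring
  rw [e, sub_eq_add_neg 1 (ε / inradius Ω)]
  exact mul_le_mul_of_nonneg_left (by linarith) hv

end EuclideanSpace

end InnerNeighbourhood

end

/-! ### The main theorem. -/

theorem proposition5 {n : ℕ} (hn : 1 ≤ n) (Ω : Set (EuclideanSpace ℝ (Fin n)))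
    (hΩ : InnerNeighbourhood.IsPolytope Ω) :
    ContDiffOn ℝ 1 (fun ε : ℝ => InnerNeighbourhood.vol (InnerNeighbourhood.innerNhd Ω ε))
        (Set.Icc 0 (InnerNeighbourhood.inradius Ω)) ∧
      AntitoneOn
        (derivWithin (fun ε : ℝ => InnerNeighbourhood.vol (InnerNeighbourhood.innerNhd Ω ε))
          (Set.Icc 0 (InnerNeighbourhood.inradius Ω)))
        (Set.Icc 0 (InnerNeighbourhood.inradius Ω)) ∧
      ConcaveOn ℝ (Set.Ici 0)
        (fun ε : ℝ => InnerNeighbourhood.vol (InnerNeighbourhood.innerNhd Ω ε)) ∧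
      ∀ ε ∈ Set.Icc 0 (InnerNeighbourhood.inradius Ω),
        InnerNeighbourhood.vol (InnerNeighbourhood.innerNhd Ω ε) ≥
            ε * (InnerNeighbourhood.vol Ω / InnerNeighbourhood.inradius Ω) ∧
          ε * (InnerNeighbourhood.vol Ω / InnerNeighbourhood.inradius Ω) ≥
            InnerNeighbourhood.g Ω ε / n := by
  open InnerNeighbourhood in
  have hpos := hΩ.inradius_pos hn
  have hbdd := hΩ.isBounded
  have hne : Ω.Nonempty := hΩ.interior_nonempty.mono interior_subset
  obtain ⟨A, b, hA, rfl⟩ := hΩ.exists_eq_polyhedron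
  obtain ⟨ρ, hρ, p, hp⟩ := exists_mem_polyhedron_of_lt_inradius hA hne hpos
  have hb := isBounded_polyhedron_neg_one hbdd hρ hp
  have hV : EqOn (fun ε : ℝ => layerVol volume A b ε - layerVol volume A b 0)
      (fun ε : ℝ => vol (innerNhd (polyhedron A b 0) ε)) (Ici 0) :=
    fun ε hε => (vol_innerNhd_polyhedron hA hb hε).symm
  have hconc : ConcaveOn ℝ (Ici 0) (fun ε : ℝ => vol (innerNhd (polyhedron A b 0) ε)) := by
    refine ConcaveOn.congr ?_ hV
    have h := ((concaveOn_layerVol volume hA hb).subset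
      (Ici_subset_Ici.2 (by norm_num)) (convex_Ici 0)).add_const (-layerVol volume A b 0)
    exact h.congr fun ε _ => (sub_eq_add_neg _ _).symm
  have hdiff : DifferentiableOn ℝ (fun ε : ℝ => vol (innerNhd (polyhedron A b 0) ε))
      (Icc 0 (inradius (polyhedron A b 0))) :=
    ((differentiableOn_layerVol hA hb hne).sub_const _).congr fun ε hε => (hV hε.1).symm
  have hanti := (hconc.subset Icc_subset_Ici_self (convex_Icc _ _)).antitoneOn_derivWithin hdiff
  refine ⟨contDiffOn_one_of_antitoneOn_derivWithin hpos hdiff hanti, hanti, hconc, ?_⟩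
  intro ε hε
  refine ⟨?_, g_div_le hn hpos hε.2⟩
  have h0 : vol (innerNhd (polyhedron A b 0) 0) = 0 := by
    rw [vol_innerNhd_polyhedron hA hb le_rfl, sub_self]
  have hs : ε / inradius (polyhedron A b 0) ≤ 1 := (div_le_one hpos).2 hε.2
  -- Concavity on the chord from 0, where the volume is 0, to the inradius, where the neighbourhood
  -- is all of Ω.
  have h := hconc.2 self_mem_Ici (mem_Ici.2 hpos.le)
    (sub_nonneg.2 hs) (div_nonneg hε.1 hpos.le) (by ring)
  simp only [smul_eq_mul, mul_zero, zero_add, h0, div_mul_cancel₀ _ hpos.ne',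
    innerNhd_inradius hn hA hbdd hpos.le] at h
  rw [ge_iff_le, mul_div_left_comm, mul_comm]
  exact h
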